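/- For a permutation $\sigma=\sigma_1\cdots\sigma_n\in\mathfrak S_n$ let $d(\sigma)$ be the number of descents of $\sigma$, i.e. of positions $i\in\{1,\dots,n-1\}$ with $\sigma_i>\sigma_{i+1}$, and let $\hat d(\sigma)$ be the number of alternating descents of $\sigma$, i.e. of positions $i\in\{1,\dots,n-1\}$ such that either $i$ is odd and $\sigma_i>\sigma_{i+1}$, or $i$ is even and $\sigma_i<\sigma_{i+1}$. Put $$A_n(t)=\sum_{\sigma\in\mathfrak S_n}t^{d(\sigma)+1},\qquad \hat A_n(t)=\sum_{\sigma\in\mathfrak S_n}t^{\hat d(\sigma)+1}.$$ For a composition $\gamma=(\gamma_1,\dots,\gamma_k)$ of $n$ (written $\gamma\models n$) let $$M_\gamma=\sum_{1\le i_1<\cdots<i_k}x_{i_1}^{\gamma_1}\cdots x_{i_k}^{\gamma_k}$$ be the monomial quasisymmetric function in the variables $x_1,x_2,\dots$, and let $\binom n\gamma=\frac{n!}{\gamma_1!\cdots\gamma_k!}$. For a formal power series $f(x)=1+\sum_{n\ge1}a_n\frac{x^n}{n!}$ with rational coefficients define $$g_{f,n}=\sum_{\gamma=(\gamma_1,\dots,\gamma_k)\models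 n}\binom n\gamma\,a_{\gamma_1}\cdots a_{\gamma_k}\,M_\gamma ,$$ and let $g_{f,n}(1^m)$ denote the value of $g_{f,n}$ at $x_1=\cdots=x_m=1$, $x_{m+1}=x_{m+2}=\cdots=0$. **Proposition.** For every integer $n\ge0$, as identities of formal power series in $t$, $$\frac{A_n(t)}{(1-t)^{n+1}}=\sum_{m\ge1}g_{\exp,n}(1^m)\,t^m \qquad\text{and}\qquad \frac{\hat A_n(t)}{(1-t)^{n+1}}=\sum_{m\ge1}g_{\tan+\sec,n}(1^m)\,t^m,$$ where $\exp$ and $\tan+\sec$ stand for the formal power series of $e^x$ and of $\tan x+\sec x$. (For $n=0$, $\mathfrak S_0$ has one element, so $A_0(t)=\hat A_0(t)=t$, and the only composition of $0$ is the empty one, so $g_{f,0}=1$.) -/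

import Mathlib

namespace AltEulerian

/-- The descent set of `σ ∈ 𝔖ₙ`, viewed as the word `σ 0, σ 1, …, σ (n - 1)`: the positions at
which a letter is followed by a smaller one. Positions are counted from `0`, so `i : Fin n` is the
usual position `i + 1 ∈ {1, …, n - 1}`. -/
def descentSet {n : ℕ} (σ : Equiv.Perm (Fin n)) : Finset (Fin n) :=
  Finset.univ.filter fun i => ∃ h : (i : ℕ) + 1 < n, σ ⟨i + 1, h⟩ < σ i

/-- The alternating descent set of `σ ∈ 𝔖ₙ`: the positions which are odd and carry a descent, or
which are even and carry an ascent. Parity refers to the usual position `i + 1`, counted from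
`1`. -/
def altDescentSet {n : ℕ} (σ : Equiv.Perm (Fin n)) : Finset (Fin n) :=
  Finset.univ.filter fun i => ∃ h : (i : ℕ) + 1 < n,
    (Odd ((i : ℕ) + 1) ∧ σ ⟨i + 1, h⟩ < σ i) ∨ (Even ((i : ℕ) + 1) ∧ σ i < σ ⟨i + 1, h⟩)

/-- The Eulerian polynomial `A_n(t) = ∑_{σ ∈ 𝔖ₙ} t^{d(σ) + 1}`. -/
noncomputable def eulerianPoly (n : ℕ) : Polynomial ℚ :=
  ∑ σ : Equiv.Perm (Fin n), Polynomial.X ^ ((descentSet σ).card + 1)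

/-- The alternating Eulerian polynomial `Â_n(t) = ∑_{σ ∈ 𝔖ₙ} t^{d̂(σ) + 1}`. -/
noncomputable def altEulerianPoly (n : ℕ) : Polynomial ℚ :=
  ∑ σ : Equiv.Perm (Fin n), Polynomial.X ^ ((altDescentSet σ).card + 1)

/-- The monomial quasisymmetric function
`M_γ = ∑_{i₁ < ⋯ < i_k} x_{i₁}^{γ₁} ⋯ x_{i_k}^{γ_k}`, a formal power series in the infinitely many
variables `x_i`, `i : ℕ` (the usual `x₁, x₂, …`, counted from `0`). Its coefficient at an exponent
vector `d` is the number of index sequences `i₁ < ⋯ < i_k` whose monomial has exponent vector `d`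
(there is at most one of them, as the parts of `γ` are positive). -/
noncomputable def monomialQSym {n : ℕ} (γ : Composition n) : MvPowerSeries ℕ ℚ :=
  fun d => (Nat.card {i : Fin γ.length ↪o ℕ //
    ∑ j : Fin γ.length, Finsupp.single (i j) (γ.blocksFun j) = d} : ℚ)

/-- The numbers `a_n` in `f(x) = ∑ a_n xⁿ / n!`. -/
noncomputable def egfCoeff (f : PowerSeries ℚ) (n : ℕ) : ℚ :=
  (n.factorial : ℚ) * PowerSeries.coeff n f

/-- `g_{f,n} = ∑_{γ ⊨ n} (n choose γ) a_{γ₁} a_{γ₂} ⋯ M_γ`, where `f(x) = 1 + ∑ a_n xⁿ / n!`. -/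
noncomputable def gSym (f : PowerSeries ℚ) (n : ℕ) : MvPowerSeries ℕ ℚ :=
  ∑ γ : Composition n,
    ((Nat.multinomial Finset.univ γ.blocksFun : ℚ) *
      ∏ j : Fin γ.length, egfCoeff f (γ.blocksFun j)) • monomialQSym γ

/-- Evaluation of a formal power series `g` at `x₁ = ⋯ = x_m = 1`, `x_{m+1} = x_{m+2} = ⋯ = 0`:
the sum over all exponent vectors `d` of the coefficient of `g` at `d` times the value of the
monomial `x^d`. For a series `g` of bounded degree, such as `g_{f,n}`, only finitely many summands
are nonzero. -/
noncomputable def evalOnes (g : MvPowerSeries ℕ ℚ) (m : ℕ) : ℚ :=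
  ∑ᶠ d : ℕ →₀ ℕ, MvPowerSeries.coeff d g * d.prod fun i e => (if i < m then (1 : ℚ) else 0) ^ e

/-- The formal power series of `tan x + sec x`, that is `sin x / cos x + 1 / cos x`. -/
noncomputable def tanAddSec : PowerSeries ℚ :=
  PowerSeries.sin ℚ * (PowerSeries.cos ℚ)⁻¹ + (PowerSeries.cos ℚ)⁻¹

end AltEulerian

/-! ### Specialising `gSym` to powers of `f`. -/

namespace AltEulerian

open Finset

/-! Since `f` has constant term 1, expanding `f ^ m` gives `g_{f,n}(1^m) = n! [xⁿ] f(x)^m`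
(`evalOnes_gSym`). It remains to prove a Worpitzky-type identity for each statistic.

Both come from refining by the first letter. Deleting the first letter `j` loses one descent exactly
when the next letter is below `j`; for alternating descents the rest must also be complemented,
because the parity of positions shifts. So the generating functions `c n a` of permutations of `n +
1` letters starting with `a` satisfy `c (n+1) (a+1) = c (n+1) a + (t-1) c n (e⁻¹ a)` and `c (n+1)
(n+1) = t c (n+1) 0`, where `e` is the identity or the complement. These relations determine `c`
(`eq_pow_mul_of_recurrence`), so it suffices to exhibit a solution whose boundary values are the
required numbers (`sum_pow_stat_eq`).

For descents the solution is `m^a (m+1)^b`. For alternating descents it is given by the coefficients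
of `F(x,y) = f(x+y)^m (c-s)(x-y) / (c-s)(x+y)`, with `f = tan + sec = (c+s)/(c-s)` and `c`, `s` the
half-angle series. As `(c-s)' = -(c+s)/2` and `(c-s)(-z) = (c+s)(z)`, it satisfies `F_x - F_y =
-F(y,x)`, and it restricts to `f^m` on `y = 0` and to `f^(m+1)` on `x = 0`. -/

theorem sum_single_apply {k : ℕ} (i : Fin k ↪o ℕ) (b : Fin k → ℕ) (j : Fin k) :
    (∑ l, Finsupp.single (i l) (b l)) (i j) = b j := by
  classical
  rw [Finsupp.finsetSum_apply]
  simp [Finsupp.single_apply]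

theorem support_sum_single {k : ℕ} (i : Fin k ↪o ℕ) (b : Fin k → ℕ) (hb : ∀ j, 0 < b j) :
    (∑ l, Finsupp.single (i l) (b l)).support = univ.map i.toEmbedding := by
  classical
  ext x
  by_cases hx : ∃ j, i j = x
  · obtain ⟨j, rfl⟩ := hx
    simp only [Finsupp.mem_support_iff, sum_single_apply]
    simp [(hb j).ne']
  · have h : (∑ l, Finsupp.single (i l) (b l)) x = 0 := by
      rw [Finsupp.finsetSum_apply]
      refine sum_eq_zero fun l _ => Finsupp.single_eq_of_ne fun h => hx ⟨l, h.symm⟩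
    simp only [Finsupp.mem_support_iff, h]
    simpa using hx

theorem ofFn_eq_sort_support {k : ℕ} (i : Fin k ↪o ℕ) (b : Fin k → ℕ) (hb : ∀ j, 0 < b j) :
    List.ofFn i = (∑ l, Finsupp.single (i l) (b l)).support.sort := by
  rw [support_sum_single i b hb]
  have hs : (List.ofFn i).SortedLT := i.strictMono.sortedLT_ofFn
  have h : (List.ofFn i).toFinset = univ.map i.toEmbedding := by
    ext x
    simp [List.mem_ofFn]
  rw [← h]
  exact ((List.toFinset_sort (r := (· ≤ ·)) hs.nodup).2 hs.sortedLE.pairwise).symm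

theorem blocks_eq_map_sort_support {n : ℕ} (γ : Composition n) (i : Fin γ.length ↪o ℕ) :
    γ.blocks = (∑ l, Finsupp.single (i l) (γ.blocksFun l)).support.sort.map
      ⇑(∑ l, Finsupp.single (i l) (γ.blocksFun l)) := by
  rw [← ofFn_eq_sort_support i _ (fun j => γ.one_le_blocksFun j), List.map_ofFn]
  conv_lhs => rw [← γ.ofFn_blocksFun]
  congr 1
  funext j
  exact (sum_single_apply i _ j).symm

/-- The indices are the support of `d` in increasing order and the parts are the values of `d` along
it, so `d` determines both. -/
theorem subsingleton_monomial (n : ℕ) (d : ℕ →₀ ℕ) :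
    Subsingleton (Σ γ : Composition n, {i : Fin γ.length ↪o ℕ //
      ∑ j : Fin γ.length, Finsupp.single (i j) (γ.blocksFun j) = d}) := by
  refine ⟨fun ⟨γ, i, hi⟩ ⟨γ', i', hi'⟩ => ?_⟩
  have h : γ = γ' := by
    apply Composition.ext
    rw [blocks_eq_map_sort_support γ i, blocks_eq_map_sort_support γ' i', hi, hi']
  subst h
  have h : i = i' := by
    have h := ofFn_eq_sort_support i _ (fun j => γ.one_le_blocksFun j)
    have h' := ofFn_eq_sort_support i' _ (fun j => γ.one_le_blocksFun j)
    rw [hi] at h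
    rw [hi', ← h] at h'
    exact DFunLike.coe_injective (List.ofFn_injective h'.symm)
  subst h
  rfl

theorem nonempty_monomial (n : ℕ) (d : ℕ →₀ ℕ) (hd : d.degree = n) :
    Nonempty (Σ γ : Composition n, {i : Fin γ.length ↪o ℕ //
      ∑ j : Fin γ.length, Finsupp.single (i j) (γ.blocksFun j) = d}) := by
  let γ : Composition n :=
    { blocks := d.support.sort.map d
      blocks_pos := by
        intro x hx
        simp only [List.mem_map, mem_sort, Finsupp.mem_support_iff] at hx
        obtain ⟨y, hy, rfl⟩ := hx
        omega
      blocks_sum := by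
        rw [← hd, Finsupp.degree_apply, ← Finset.sum_map_toList]
        exact ((Finset.sort_perm_toList _ _).map d).sum_eq }
  have hl : d.support.card = γ.length := by simp [γ, Composition.length]
  refine ⟨γ, d.support.orderEmbOfFin hl, ?_⟩
  have hb : ∀ j, γ.blocksFun j = d (d.support.orderEmbOfFin hl j) := by
    intro j
    simp [γ, Composition.blocksFun, Finset.orderEmbOfFin_apply]
  simp only [hb]
  conv_rhs => rw [← Finsupp.sum_single d, Finsupp.sum, ← Finset.map_orderEmbOfFin_univ _ hl]
  rw [Finset.sum_map]
  rfl

theorem sum_card_monomial (n : ℕ) (d : ℕ →₀ ℕ) (hd : d.degree = n) :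
    ∑ γ : Composition n, Nat.card {i : Fin γ.length ↪o ℕ //
      ∑ j : Fin γ.length, Finsupp.single (i j) (γ.blocksFun j) = d} = 1 := by
  have := subsingleton_monomial n d
  have := nonempty_monomial n d hd
  have hs : ∀ γ : Composition n, Subsingleton {i : Fin γ.length ↪o ℕ //
      ∑ j : Fin γ.length, Finsupp.single (i j) (γ.blocksFun j) = d} := fun γ =>
    ⟨fun x y => eq_of_heq (Sigma.mk.inj (Subsingleton.elim
      (⟨γ, x⟩ : Σ γ : Composition n, {i : Fin γ.length ↪o ℕ //
        ∑ j : Fin γ.length, Finsupp.single (i j) (γ.blocksFun j) = d}) ⟨γ, y⟩)).2⟩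
  rw [← Nat.card_sigma]
  exact Nat.card_of_subsingleton (Classical.arbitrary _)

theorem multinomial_mul_prod_egfCoeff (f : PowerSeries ℚ) {n : ℕ} (γ : Composition n) :
    (Nat.multinomial univ γ.blocksFun : ℚ) * ∏ j, egfCoeff f (γ.blocksFun j) =
      n.factorial * ∏ j, PowerSeries.coeff (γ.blocksFun j) f := by
  have h := Nat.multinomial_spec univ γ.blocksFun
  rw [γ.sum_blocksFun] at h
  rw [← h]
  simp only [egfCoeff, prod_mul_distrib]
  push_cast
  ring

theorem coeff_monomialQSym_eq_zero {n : ℕ} (γ : Composition n) (d : ℕ →₀ ℕ) (hd : d.degree ≠ n) :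
    MvPowerSeries.coeff d (monomialQSym γ) = 0 := by
  change (Nat.card {i : Fin γ.length ↪o ℕ //
    ∑ j : Fin γ.length, Finsupp.single (i j) (γ.blocksFun j) = d} : ℚ) = 0
  have : IsEmpty {i : Fin γ.length ↪o ℕ //
      ∑ j : Fin γ.length, Finsupp.single (i j) (γ.blocksFun j) = d} := by
    refine ⟨fun ⟨i, hi⟩ => hd ?_⟩
    rw [← hi, map_sum]
    simp [γ.sum_blocksFun]
  simp

theorem coeff_gSym_eq_zero (f : PowerSeries ℚ) (n : ℕ) (d : ℕ →₀ ℕ) (hd : d.degree ≠ n) :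
    MvPowerSeries.coeff d (gSym f n) = 0 := by
  rw [gSym, map_sum]
  refine sum_eq_zero fun γ _ => ?_
  rw [MvPowerSeries.coeff_smul, coeff_monomialQSym_eq_zero γ d hd, mul_zero]

/-- Exactly one composition contributes to a given `d`, and the factorials in `egfCoeff` cancel
those in the multinomial coefficient. -/
theorem coeff_gSym (f : PowerSeries ℚ) (n : ℕ) (d : ℕ →₀ ℕ) (hd : d.degree = n) :
    MvPowerSeries.coeff d (gSym f n) =
      n.factorial * ∏ i ∈ d.support, PowerSeries.coeff (d i) f := by
  have key : ∀ γ : Composition n, MvPowerSeries.coeff d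
      (((Nat.multinomial univ γ.blocksFun : ℚ) * ∏ j, egfCoeff f (γ.blocksFun j)) •
        monomialQSym γ) = (n.factorial * ∏ i ∈ d.support, PowerSeries.coeff (d i) f) *
      (Nat.card {i : Fin γ.length ↪o ℕ //
        ∑ j : Fin γ.length, Finsupp.single (i j) (γ.blocksFun j) = d} : ℚ) := by
    intro γ
    rw [MvPowerSeries.coeff_smul, multinomial_mul_prod_egfCoeff]
    change _ * (Nat.card {i : Fin γ.length ↪o ℕ //
      ∑ j : Fin γ.length, Finsupp.single (i j) (γ.blocksFun j) = d} : ℚ) = _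
    rcases isEmpty_or_nonempty {i : Fin γ.length ↪o ℕ //
      ∑ j : Fin γ.length, Finsupp.single (i j) (γ.blocksFun j) = d} with h | ⟨i, hi⟩
    · simp
    · congr 2
      rw [← hi, support_sum_single i _ (fun j => γ.one_le_blocksFun j), prod_map]
      refine prod_congr rfl fun j _ => ?_
      rw [← sum_single_apply i γ.blocksFun j]
      rfl
  rw [gSym, map_sum, sum_congr rfl fun γ _ => key γ, ← mul_sum, ← Nat.cast_sum,
    sum_card_monomial n d hd, Nat.cast_one, mul_one]

/-- `g_{f,n}(1^m) = n! [xⁿ] f(x)^m`. -/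
theorem evalOnes_gSym (f : PowerSeries ℚ) (hf : PowerSeries.constantCoeff f = 1) (n m : ℕ) :
    evalOnes (gSym f n) m = egfCoeff (f ^ m) n := by
  classical
  have hdeg : ∀ d ∈ finsuppAntidiag (range m) n, d.degree = n := by
    intro d hd
    rw [mem_finsuppAntidiag] at hd
    rw [Finsupp.degree_apply, ← hd.1]
    exact sum_subset hd.2 fun i _ hi => Finsupp.notMem_support_iff.1 hi
  rw [evalOnes, finsum_eq_sum_of_support_subset (s := finsuppAntidiag (range m) n)]
  · rw [egfCoeff, PowerSeries.coeff_pow, mul_sum]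
    refine sum_congr rfl fun d hd => ?_
    rw [coeff_gSym f n d (hdeg d hd)]
    rw [mem_finsuppAntidiag] at hd
    have h1 : (d.prod fun i e => (if i < m then (1 : ℚ) else 0) ^ e) = 1 := by
      refine prod_eq_one fun i hi => ?_
      simp [mem_range.1 (hd.2 hi)]
    rw [h1, mul_one]
    congr 1
    -- Indices below `m` outside the support contribute the constant term of `f`, which is 1.
    refine prod_subset hd.2 fun i _ hi => ?_
    rw [Finsupp.notMem_support_iff.1 hi, PowerSeries.coeff_zero_eq_constantCoeff_apply, hf]
  · intro d hd
    rw [Function.mem_support] at hd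
    have h1 : d.degree = n := by
      by_contra h
      exact hd (by rw [coeff_gSym_eq_zero f n d h, zero_mul])
    have h2 : d.support ⊆ range m := by
      intro i hi
      by_contra h
      refine hd ?_
      rw [Finsupp.prod, prod_eq_zero hi, mul_zero]
      rw [mem_range] at h
      simp [h, Finsupp.mem_support_iff.1 hi]
    rw [mem_coe, mem_finsuppAntidiag]
    refine ⟨?_, h2⟩
    rw [← h1, Finsupp.degree_apply]
    exact (sum_subset h2 fun i _ hi => Finsupp.notMem_support_iff.1 hi).symm

end AltEulerian

/-! ### Half-angle series and the bivariate refinement of `(tan + sec)^m`. -/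

namespace AltEulerian

open PowerSeries

local notation "D" => PowerSeries.derivative ℚ

theorem egfCoeff_eq_constantCoeff_iterate (f : PowerSeries ℚ) (n : ℕ) :
    egfCoeff f n = constantCoeff ((D)^[n] f) := by
  rw [constantCoeff_iterate_derivative, egfCoeff]

theorem derivative_sin : D (PowerSeries.sin ℚ) = PowerSeries.cos ℚ := by
  ext n
  rw [coeff_derivative]
  simp only [PowerSeries.sin, PowerSeries.cos, coeff_mk, Nat.even_add_one]
  have : (n.factorial : ℚ) ≠ 0 := by positivity
  have : (n : ℚ) + 1 ≠ 0 := by positivity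
  by_cases h : Even n
  · obtain ⟨k, rfl⟩ := h
    have h1 : (k + k + 1) / 2 = k := by omega
    have h2 : (k + k) / 2 = k := by omega
    simp [h1, h2, Nat.factorial_succ]
    field_simp
  · simp [h]

theorem derivative_cos : D (PowerSeries.cos ℚ) = -PowerSeries.sin ℚ := by
  ext n
  rw [coeff_derivative, map_neg]
  simp only [PowerSeries.sin, PowerSeries.cos, coeff_mk, Nat.even_add_one]
  have : (n.factorial : ℚ) ≠ 0 := by positivity
  have : (n : ℚ) + 1 ≠ 0 := by positivity
  by_cases h : Even n
  · simp [h]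
  · obtain ⟨k, rfl⟩ := Nat.not_even_iff_odd.1 h
    have h1 : (2 * k + 1 + 1) / 2 = k + 1 := by omega
    have h2 : (2 * k + 1) / 2 = k := by omega
    simp [h1, h2, Nat.factorial_succ, pow_succ]
    field_simp

theorem constantCoeff_sin : constantCoeff (PowerSeries.sin ℚ) = 0 := by
  rw [← coeff_zero_eq_constantCoeff_apply]; simp [PowerSeries.sin]

theorem constantCoeff_cos : constantCoeff (PowerSeries.cos ℚ) = 1 := by
  rw [← coeff_zero_eq_constantCoeff_apply]; simp [PowerSeries.cos]

theorem derivative_rescale (a : ℚ) (f : PowerSeries ℚ) :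
    D (rescale a f) = C a * rescale a (D f) := by
  ext n
  simp only [coeff_derivative, coeff_rescale, coeff_C_mul]
  ring

theorem eq_zero_of_harmonic (u v : PowerSeries ℚ) (hu : D u = -v) (hv : D v = u)
    (hu0 : constantCoeff u = 0) (hv0 : constantCoeff v = 0) : u = 0 ∧ v = 0 := by
  have key : ∀ n, coeff n u = 0 ∧ coeff n v = 0 := by
    intro n
    induction n with
    | zero => simp [hu0, hv0]
    | succ n ih =>
      have h1 := congrArg (coeff n) hu
      have h2 := congrArg (coeff n) hv
      rw [coeff_derivative] at h1 h2
      rw [map_neg, ih.2, neg_zero] at h1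
      rw [ih.1] at h2
      have h3 : (n : ℚ) + 1 ≠ 0 := by positivity
      exact ⟨(mul_eq_zero.1 h1).resolve_right h3, (mul_eq_zero.1 h2).resolve_right h3⟩
  exact ⟨ext fun n => by simp [(key n).1], ext fun n => by simp [(key n).2]⟩

/-- The power series of `cos (x / 2)`. -/
noncomputable def cosHalf : PowerSeries ℚ := rescale (1 / 2) (PowerSeries.cos ℚ)

/-- The power series of `sin (x / 2)`. -/
noncomputable def sinHalf : PowerSeries ℚ := rescale (1 / 2) (PowerSeries.sin ℚ)

theorem derivative_cosHalf : D cosHalf = -(C (1 / 2) * sinHalf) := by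
  rw [cosHalf, derivative_rescale, derivative_cos, map_neg, mul_neg, sinHalf]

theorem derivative_sinHalf : D sinHalf = C (1 / 2) * cosHalf := by
  rw [sinHalf, derivative_rescale, derivative_sin, cosHalf]

theorem constantCoeff_rescale (a : ℚ) (f : PowerSeries ℚ) :
    constantCoeff (rescale a f) = constantCoeff f := by
  rw [← coeff_zero_eq_constantCoeff_apply, ← coeff_zero_eq_constantCoeff_apply, coeff_rescale]
  simp

theorem constantCoeff_cosHalf : constantCoeff cosHalf = 1 := by
  rw [cosHalf, constantCoeff_rescale, constantCoeff_cos]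

theorem constantCoeff_sinHalf : constantCoeff sinHalf = 0 := by
  rw [sinHalf, constantCoeff_rescale, constantCoeff_sin]

theorem C_half_add : (C (1 / 2) : PowerSeries ℚ) + C (1 / 2) = 1 := by
  rw [← map_add]; norm_num

/-- The differences of the two sides solve `u' = -v`, `v' = u` with zero initial values. -/
theorem double_angle :
    PowerSeries.cos ℚ = cosHalf * cosHalf - sinHalf * sinHalf ∧
      PowerSeries.sin ℚ = sinHalf * cosHalf + sinHalf * cosHalf := by
  have h := eq_zero_of_harmonic
    (PowerSeries.cos ℚ - (cosHalf * cosHalf - sinHalf * sinHalf))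
    (PowerSeries.sin ℚ - (sinHalf * cosHalf + sinHalf * cosHalf)) ?_ ?_ ?_ ?_
  · exact ⟨sub_eq_zero.1 h.1, sub_eq_zero.1 h.2⟩
  · simp only [map_sub, Derivation.leibniz, derivative_cos, derivative_cosHalf,
      derivative_sinHalf, smul_eq_mul]
    linear_combination (2 * sinHalf * cosHalf) * C_half_add
  · simp only [map_sub, map_add, Derivation.leibniz, derivative_sin, derivative_cosHalf,
      derivative_sinHalf, smul_eq_mul]
    linear_combination (sinHalf * sinHalf - cosHalf * cosHalf) * C_half_add
  · simp [constantCoeff_cos, constantCoeff_cosHalf, constantCoeff_sinHalf]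
  · simp [constantCoeff_sin, constantCoeff_cosHalf, constantCoeff_sinHalf]

theorem cosHalf_sq_add_sinHalf_sq : cosHalf * cosHalf + sinHalf * sinHalf = 1 := by
  refine derivative.ext ?_ ?_
  · rw [derivative_one]
    simp only [map_add, Derivation.leibniz, derivative_cosHalf, derivative_sinHalf, smul_eq_mul]
    ring
  · simp [constantCoeff_cosHalf, constantCoeff_sinHalf]

theorem constantCoeff_cosHalf_sub_sinHalf : constantCoeff (cosHalf - sinHalf) ≠ 0 := by
  simp [constantCoeff_cosHalf, constantCoeff_sinHalf]

/-- With `c² + s² = 1`, `1 + sin = (c+s)²` and `cos = (c-s)(c+s)`. -/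
theorem tanAddSec_mul : tanAddSec * (cosHalf - sinHalf) = cosHalf + sinHalf := by
  have h0 : constantCoeff (PowerSeries.cos ℚ) ≠ 0 := by simp [constantCoeff_cos]
  have hne : PowerSeries.cos ℚ ≠ 0 := fun h => h0 (by rw [h, map_zero])
  have h1 : PowerSeries.cos ℚ * (PowerSeries.cos ℚ)⁻¹ = 1 := PowerSeries.mul_inv_cancel _ h0
  refine mul_left_cancel₀ hne ?_
  obtain ⟨hc, hs⟩ := double_angle
  have h2 : PowerSeries.cos ℚ * tanAddSec = PowerSeries.sin ℚ + 1 := by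
    rw [tanAddSec]
    linear_combination (PowerSeries.sin ℚ + 1) * h1
  rw [← mul_assoc, h2, hc, hs]
  linear_combination (-(cosHalf - sinHalf)) * cosHalf_sq_add_sinHalf_sq

theorem constantCoeff_tanAddSec : constantCoeff tanAddSec = 1 := by
  have h := congrArg constantCoeff tanAddSec_mul
  simpa [constantCoeff_cosHalf, constantCoeff_sinHalf] using h

/-- The pair `(u, v)` stands for the bivariate series
`u(x + y) (c - s)(x - y) + v(x + y) (c + s)(x - y)`, where `c`, `s` are the series of `cos (x / 2)`,
`sin (x / 2)`; this is its derivative in `x`. -/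
noncomputable def pairDerivX (p : PowerSeries ℚ × PowerSeries ℚ) : PowerSeries ℚ × PowerSeries ℚ :=
  (D p.1 + C (1 / 2) * p.2, D p.2 - C (1 / 2) * p.1)

/-- The derivative in `y` of the bivariate series that a pair stands for, see `pairDerivX`. -/
noncomputable def pairDerivY (p : PowerSeries ℚ × PowerSeries ℚ) : PowerSeries ℚ × PowerSeries ℚ :=
  (D p.1 - C (1 / 2) * p.2, D p.2 + C (1 / 2) * p.1)

/-- The interchange of `x` and `y`, up to a sign that depends on the component. -/
def pairConj (p : PowerSeries ℚ × PowerSeries ℚ) : PowerSeries ℚ × PowerSeries ℚ := (p.1, -p.2)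

theorem pairDeriv_commute : Function.Commute pairDerivX pairDerivY := by
  intro p
  have hC : D (C (1 / 2)) = 0 := derivative_C
  ext1 <;> simp only [pairDerivX, pairDerivY, map_add, map_sub, Derivation.leibniz, smul_eq_mul,
    hC] <;> ring

theorem pairConj_semiconj_X : Function.Semiconj pairConj pairDerivX pairDerivY := by
  intro p
  ext1 <;> simp only [pairDerivX, pairDerivY, pairConj, map_neg] <;> ring

theorem pairConj_semiconj_Y : Function.Semiconj pairConj pairDerivY pairDerivX := by
  intro p
  ext1 <;> simp only [pairDerivX, pairDerivY, pairConj, map_neg] <;> ring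

/-- The coefficients `a! b! [x^a y^b]` of the bivariate series that a pair stands for. -/
noncomputable def pairCoeff (p : PowerSeries ℚ × PowerSeries ℚ) (a b : ℕ) : ℚ :=
  constantCoeff (pairDerivX^[a] (pairDerivY^[b] p)).1 +
    constantCoeff (pairDerivX^[a] (pairDerivY^[b] p)).2

/-- This is `F_x - F_y = -F(y,x)` for `F = g(x+y) (c-s)(x-y)`. On pairs, the difference of the
derivatives of `(u, v)` is `(v, -u)`, whose value at the origin is minus that of `pairConj (u, v)`;
and `pairConj` fixes `(g, 0)` while exchanging the two derivatives. -/
theorem pairCoeff_succ (g : PowerSeries ℚ) (a b : ℕ) :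
    pairCoeff (g, 0) (a + 1) b = pairCoeff (g, 0) a (b + 1) - pairCoeff (g, 0) b a := by
  have h1 : pairDerivX^[a + 1] (pairDerivY^[b] (g, 0)) =
      pairDerivX (pairDerivX^[a] (pairDerivY^[b] (g, 0))) :=
    Function.iterate_succ_apply' _ _ _
  have h2 : pairDerivX^[a] (pairDerivY^[b + 1] (g, 0)) =
      pairDerivY (pairDerivX^[a] (pairDerivY^[b] (g, 0))) := by
    rw [Function.iterate_succ_apply']
    exact (pairDeriv_commute.iterate_left a) _
  have h3 : pairDerivX^[b] (pairDerivY^[a] (g, 0)) =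
      pairConj (pairDerivX^[a] (pairDerivY^[b] (g, 0))) := by
    rw [(pairConj_semiconj_X.iterate_right a) _, (pairConj_semiconj_Y.iterate_right b) _,
      ((pairDeriv_commute.iterate_left b).iterate_right a) _]
    simp [pairConj]
  rw [pairCoeff, pairCoeff, pairCoeff, h1, h2, h3]
  generalize pairDerivX^[a] (pairDerivY^[b] (g, 0)) = p
  simp only [pairDerivX, pairDerivY, pairConj, map_add, map_sub, map_neg, map_mul,
    constantCoeff_C]
  ring

/-- Restriction to `y = 0` intertwines `pairDerivX` with the ordinary derivative. -/
theorem pairCoeff_zero_right (g : PowerSeries ℚ) (n : ℕ) :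
    pairCoeff (g, 0) n 0 = egfCoeff (g * (cosHalf - sinHalf)) n := by
  have h : Function.Semiconj
      (fun p : PowerSeries ℚ × PowerSeries ℚ =>
        p.1 * (cosHalf - sinHalf) + p.2 * (cosHalf + sinHalf)) pairDerivX (D) := by
    intro p
    simp only [pairDerivX, map_add, map_sub, Derivation.leibniz, smul_eq_mul, derivative_cosHalf,
      derivative_sinHalf]
    ring
  have h1 := (h.iterate_right n) (g, 0)
  rw [egfCoeff_eq_constantCoeff_iterate, pairCoeff, Function.iterate_zero, id]
  simp only [zero_mul, add_zero] at h1
  rw [← h1]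
  simp [constantCoeff_cosHalf, constantCoeff_sinHalf]

/-- Restriction to `x = 0` turns `(c-s)(x-y)` into `(c-s)(-y) = (c+s)(y)`, which swaps the two
factors. -/
theorem pairCoeff_zero_left (g : PowerSeries ℚ) (n : ℕ) :
    pairCoeff (g, 0) 0 n = egfCoeff (g * (cosHalf + sinHalf)) n := by
  have h : Function.Semiconj
      (fun p : PowerSeries ℚ × PowerSeries ℚ =>
        p.1 * (cosHalf + sinHalf) + p.2 * (cosHalf - sinHalf)) pairDerivY (D) := by
    intro p
    simp only [pairDerivY, map_add, map_sub, Derivation.leibniz, smul_eq_mul, derivative_cosHalf,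
      derivative_sinHalf]
    ring
  have h1 := (h.iterate_right n) (g, 0)
  rw [egfCoeff_eq_constantCoeff_iterate, pairCoeff, Function.iterate_zero, id]
  simp only [zero_mul, add_zero] at h1
  rw [← h1]
  simp [constantCoeff_cosHalf, constantCoeff_sinHalf]

/-- The numbers `a! b! [x^a y^b]` of `f(x + y)^m (c - s)(x - y) / (c - s)(x + y)`, where `f` is the
series of `tan + sec` and `c`, `s` are those of `cos (x / 2)`, `sin (x / 2)`. -/
noncomputable def tanAddSecPowRefined (m : ℕ) : ℕ → ℕ → ℚ :=
  pairCoeff (tanAddSec ^ m * (cosHalf - sinHalf)⁻¹, 0)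

theorem tanAddSecPowRefined_zero_right (m n : ℕ) :
    tanAddSecPowRefined m n 0 = egfCoeff (tanAddSec ^ m) n := by
  rw [tanAddSecPowRefined, pairCoeff_zero_right, mul_assoc,
    PowerSeries.inv_mul_cancel _ constantCoeff_cosHalf_sub_sinHalf, mul_one]

theorem tanAddSecPowRefined_zero_left (m n : ℕ) :
    tanAddSecPowRefined m 0 n = egfCoeff (tanAddSec ^ (m + 1)) n := by
  rw [tanAddSecPowRefined, pairCoeff_zero_left, ← tanAddSec_mul]
  congr 1
  linear_combination (tanAddSec ^ (m + 1)) *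
    PowerSeries.inv_mul_cancel _ constantCoeff_cosHalf_sub_sinHalf

theorem egfCoeff_exp_pow (m n : ℕ) : egfCoeff (PowerSeries.exp ℚ ^ m) n = (m : ℚ) ^ n := by
  have : (n.factorial : ℚ) ≠ 0 := by positivity
  rw [egfCoeff, exp_pow_eq_rescale_exp, coeff_rescale, coeff_exp]
  simp
  field_simp

end AltEulerian

/-! ### Recurrence on the first letter. -/

namespace AltEulerian

open Finset

/-- The permutation of `Fin (n + 1)` whose word starts with `j` and goes on with the word of `τ`,
relabelled by the letters other than `j`. -/
def consPerm {n : ℕ} (j : Fin (n + 1)) (τ : Equiv.Perm (Fin n)) : Equiv.Perm (Fin (n + 1)) :=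
  (finSuccEquiv' 0).trans ((Equiv.optionCongr τ).trans (finSuccEquiv' j).symm)

@[simp]
theorem consPerm_zero {n : ℕ} (j : Fin (n + 1)) (τ : Equiv.Perm (Fin n)) :
    consPerm j τ 0 = j := by
  simp [consPerm]

@[simp]
theorem consPerm_succ {n : ℕ} (j : Fin (n + 1)) (τ : Equiv.Perm (Fin n)) (i : Fin n) :
    consPerm j τ i.succ = j.succAbove (τ i) := by
  simp [consPerm, finSuccEquiv'_zero]

theorem consPerm_bijective (n : ℕ) : Function.Bijective
    (fun p : Fin (n + 1) × Equiv.Perm (Fin n) => consPerm p.1 p.2) := by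
  rw [Fintype.bijective_iff_injective_and_card]
  constructor
  · rintro ⟨j, τ⟩ ⟨j', τ'⟩ h
    have h0 := DFunLike.congr_fun h 0
    simp only [consPerm_zero] at h0
    subst h0
    congr 1
    ext1 i
    have hi := DFunLike.congr_fun h i.succ
    simp only [consPerm_succ] at hi
    exact Fin.succAbove_right_injective hi
  · simp [Fintype.card_perm, Nat.factorial_succ]

theorem exists_prop_iff_exists_prop {p p' : Prop} {q : p → Prop} {q' : p' → Prop} (hp : p ↔ p')
    (hq : ∀ h h', q h ↔ q' h') : (∃ h, q h) ↔ ∃ h, q' h :=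
  ⟨fun ⟨h, a⟩ => ⟨hp.1 h, (hq _ _).1 a⟩, fun ⟨h, a⟩ => ⟨hp.2 h, (hq _ _).2 a⟩⟩

theorem card_descentSet_consPerm {n : ℕ} (j : Fin (n + 2)) (τ : Equiv.Perm (Fin (n + 1))) :
    (descentSet (consPerm j τ)).card =
      (descentSet τ).card + if (τ 0).castSucc < j then 1 else 0 := by
  classical
  have hs : ∀ i : Fin (n + 1),
      (∃ h : ((i.succ : Fin (n + 2)) : ℕ) + 1 < n + 2,
        consPerm j τ ⟨(i.succ : ℕ) + 1, h⟩ < consPerm j τ i.succ) ↔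
      ∃ h : (i : ℕ) + 1 < n + 1, τ ⟨i + 1, h⟩ < τ i := by
    intro i
    have hp : (i.succ : ℕ) + 1 < n + 2 ↔ (i : ℕ) + 1 < n + 1 := Nat.succ_lt_succ_iff
    refine exists_prop_iff_exists_prop hp fun _ h => ?_
    have e : (⟨(i.succ : ℕ) + 1, Nat.succ_lt_succ h⟩ : Fin (n + 2)) =
      Fin.succ ⟨(i : ℕ) + 1, h⟩ := rfl
    rw [e, consPerm_succ, consPerm_succ, Fin.succAbove_lt_succAbove_iff]
  have h0 : (∃ h : ((0 : Fin (n + 2)) : ℕ) + 1 < n + 2,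
      consPerm j τ ⟨((0 : Fin (n + 2)) : ℕ) + 1, h⟩ < consPerm j τ 0) ↔
        (τ 0).castSucc < j := by
    have e : ∀ h, (⟨((0 : Fin (n + 2)) : ℕ) + 1, h⟩ : Fin (n + 2)) =
      Fin.succ 0 := fun _ => rfl
    simp only [e, consPerm_succ, consPerm_zero, Fin.succAbove_lt_iff_castSucc_lt]
    simp
  unfold descentSet
  rw [Fin.card_filter_univ_succ']
  simp only [hs, h0]
  rw [add_comm]

/-- Prepending a letter flips the parity of every old position, and complementing `τ` exchanges its
ascents and descents, so the old contributions survive. The new first position is odd and counts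
when it is a descent. -/
theorem card_altDescentSet_consPerm {n : ℕ} (j : Fin (n + 2)) (τ : Equiv.Perm (Fin (n + 1))) :
    (altDescentSet (consPerm j (τ.trans Fin.revPerm))).card =
      (altDescentSet τ).card + if (Fin.rev (τ 0)).castSucc < j then 1 else 0 := by
  classical
  have hs : ∀ i : Fin (n + 1),
      (∃ h : ((i.succ : Fin (n + 2)) : ℕ) + 1 < n + 2,
        (Odd ((i.succ : ℕ) + 1) ∧ consPerm j (τ.trans Fin.revPerm) ⟨(i.succ : ℕ) + 1, h⟩ <
          consPerm j (τ.trans Fin.revPerm) i.succ) ∨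
        (Even ((i.succ : ℕ) + 1) ∧ consPerm j (τ.trans Fin.revPerm) i.succ <
          consPerm j (τ.trans Fin.revPerm) ⟨(i.succ : ℕ) + 1, h⟩)) ↔
      ∃ h : (i : ℕ) + 1 < n + 1, (Odd ((i : ℕ) + 1) ∧ τ ⟨i + 1, h⟩ < τ i) ∨
        (Even ((i : ℕ) + 1) ∧ τ i < τ ⟨i + 1, h⟩) := by
    intro i
    have hp : (i.succ : ℕ) + 1 < n + 2 ↔ (i : ℕ) + 1 < n + 1 := Nat.succ_lt_succ_iff
    refine exists_prop_iff_exists_prop hp fun _ h => ?_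
    have e : (⟨(i.succ : ℕ) + 1, Nat.succ_lt_succ h⟩ : Fin (n + 2)) =
      Fin.succ ⟨(i : ℕ) + 1, h⟩ := rfl
    rw [e]
    simp only [consPerm_succ, Fin.succAbove_lt_succAbove_iff, Equiv.trans_apply,
      Fin.revPerm_apply, Fin.rev_lt_rev, Fin.val_succ]
    rw [Nat.odd_add_one, Nat.even_add_one (n := (i : ℕ) + 1), Nat.not_odd_iff_even,
      Nat.not_even_iff_odd]
    tauto
  have h0 : (∃ h : ((0 : Fin (n + 2)) : ℕ) + 1 < n + 2,
      (Odd (((0 : Fin (n + 2)) : ℕ) + 1) ∧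
        consPerm j (τ.trans Fin.revPerm) ⟨((0 : Fin (n + 2)) : ℕ) + 1, h⟩ <
          consPerm j (τ.trans Fin.revPerm) 0) ∨
      (Even (((0 : Fin (n + 2)) : ℕ) + 1) ∧ consPerm j (τ.trans Fin.revPerm) 0 <
        consPerm j (τ.trans Fin.revPerm) ⟨((0 : Fin (n + 2)) : ℕ) + 1, h⟩)) ↔
        (Fin.rev (τ 0)).castSucc < j := by
    have e : ∀ h, (⟨((0 : Fin (n + 2)) : ℕ) + 1, h⟩ : Fin (n + 2)) =
      Fin.succ 0 := fun _ => rfl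
    simp only [e, consPerm_succ, consPerm_zero, Fin.succAbove_lt_iff_castSucc_lt]
    simp
  unfold altDescentSet
  rw [Fin.card_filter_univ_succ']
  simp only [hs, h0]
  rw [add_comm]

section FirstLetter

variable {R : Type*} [CommRing R]

/-- The generating function of `stat` over `𝔖ₙ`, with an additional factor `t` for each `τ` such that
`e (τ 0) < a`. -/
def weightedSum (t : R) (stat : ∀ n, Equiv.Perm (Fin n) → ℕ) (e : ∀ n, Equiv.Perm (Fin n))
    (n a : ℕ) : R :=
  ∑ τ : Equiv.Perm (Fin n),
    t ^ stat n τ * if ∃ h : 0 < n, (e n (τ ⟨0, h⟩) : ℕ) < a then t else 1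

variable (t : R) (stat : ∀ n, Equiv.Perm (Fin n) → ℕ) (e : ∀ n, Equiv.Perm (Fin n))

theorem weightedSum_zero_right (n : ℕ) :
    weightedSum t stat e n 0 = ∑ τ : Equiv.Perm (Fin n), t ^ stat n τ := by
  simp [weightedSum]

theorem weightedSum_self (n : ℕ) :
    weightedSum t stat e (n + 1) (n + 1) = t * weightedSum t stat e (n + 1) 0 := by
  rw [weightedSum_zero_right, weightedSum, mul_sum]
  refine sum_congr rfl fun τ _ => ?_
  rw [if_pos ⟨n.succ_pos, Fin.is_lt _⟩, mul_comm]

variable (h0 : ∀ τ, stat 0 τ = 0) (h1 : ∀ τ, stat 1 τ = 0)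
  (hstat : ∀ n (j : Fin (n + 2)) (τ : Equiv.Perm (Fin (n + 1))),
    stat (n + 2) (consPerm j (τ.trans (e (n + 1)))) =
      stat (n + 1) τ + if (e (n + 1) (τ 0)).castSucc < j then 1 else 0)

include h0 h1 hstat in
-- Deleting the first letter `j` and undoing `e` on the rest is a bijection; by `hstat` the lost
-- position is recorded by the extra factor `t`.
theorem sum_first_letter_eq_weightedSum (n : ℕ) (j : Fin (n + 1)) :
    (∑ σ : Equiv.Perm (Fin (n + 1)), if σ 0 = j then t ^ stat (n + 1) σ else 0) =
      weightedSum t stat e n j := by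
  classical
  have hb : Function.Bijective (fun p : Fin (n + 1) × Equiv.Perm (Fin n) =>
      consPerm p.1 (p.2.trans (e n))) :=
    (consPerm_bijective n).comp
      ((Equiv.refl _).prodCongr (Equiv.mulLeft (e n))).bijective
  rw [← hb.sum_comp, Fintype.sum_prod_type, sum_eq_single j]
  · rw [weightedSum]
    refine sum_congr rfl fun τ _ => ?_
    rw [consPerm_zero, if_pos rfl]
    cases n with
    | zero => simp [h0, h1]
    | succ n =>
      rw [hstat, pow_add]
      congr 1
      have : (∃ h : 0 < n + 1, (e (n + 1) (τ ⟨0, h⟩) : ℕ) < j) ↔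
          (e (n + 1) (τ 0)).castSucc < j := by
        simp [Fin.lt_def]
      simp only [this]
      split_ifs <;> simp
  · intro k _ hk
    refine sum_eq_zero fun τ _ => ?_
    rw [consPerm_zero, if_neg hk]
  · simp

include h0 h1 hstat in
-- Raising the threshold from `a` to `a + 1` changes only the terms with `e (τ 0) = a`, whose extra
-- factor goes from 1 to `t`; these have a prescribed first letter.
theorem weightedSum_succ (n : ℕ) (a : Fin (n + 1)) :
    weightedSum t stat e (n + 1) (a + 1) =
      weightedSum t stat e (n + 1) a + (t - 1) * weightedSum t stat e n ((e (n + 1)).symm a) := by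
  rw [← sum_first_letter_eq_weightedSum t stat e h0 h1 hstat, mul_sum, weightedSum, weightedSum,
    ← sum_add_distrib]
  refine sum_congr rfl fun τ _ => ?_
  have hz : (⟨0, n.succ_pos⟩ : Fin (n + 1)) = 0 := rfl
  simp only [n.succ_pos, exists_true_left, hz, Equiv.eq_symm_apply, Fin.ext_iff]
  generalize ((e (n + 1) (τ 0) : Fin (n + 1)) : ℕ) = x
  rcases lt_trichotomy x (a : ℕ) with h | h | h
  · rw [if_pos (by omega), if_pos h, if_neg h.ne]; ring
  · rw [if_pos (by omega), if_neg (by omega), if_pos h]; ring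
  · rw [if_neg (by omega), if_neg (by omega), if_neg h.ne']; ring

end FirstLetter

/-- By induction on `n`, the discrepancy between the two sides at level `n + 1` does not depend on
`a`. The boundary relations make it equal to `t` times itself, so it vanishes because `1 - t ≠ 0`.
-/
theorem eq_pow_mul_of_recurrence {R : Type*} [CommRing R] [IsDomain R] {t : R} (ht : 1 - t ≠ 0)
    (τ : ∀ n, Equiv.Perm (Fin (n + 1))) (c v : ℕ → ℕ → R) (h0 : c 0 0 = (1 - t) * v 0 0)
    (hc : ∀ n (a : Fin (n + 1)), c (n + 1) (a + 1) = c (n + 1) a + (t - 1) * c n (τ n a))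
    (hct : ∀ n, c (n + 1) (n + 1) = t * c (n + 1) 0)
    (hv : ∀ n (a : Fin (n + 1)), v (n + 1) (a + 1) = v (n + 1) a - v n (τ n a))
    (hvt : ∀ n, v (n + 1) (n + 1) = t * v (n + 1) 0) (n a : ℕ) (ha : a ≤ n) :
    c n a = (1 - t) ^ (n + 1) * v n a := by
  induction n generalizing a with
  | zero =>
    obtain rfl : a = 0 := by omega
    rw [h0, zero_add, pow_one]
  | succ n ih =>
    have key : ∀ b ≤ n + 1, c (n + 1) b - (1 - t) ^ (n + 2) * v (n + 1) b =
        c (n + 1) 0 - (1 - t) ^ (n + 2) * v (n + 1) 0 := by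
      intro b hb
      induction b with
      | zero => rfl
      | succ b ihb =>
        rw [← ihb (by omega)]
        have e1 := hc n ⟨b, by omega⟩
        have e2 := hv n ⟨b, by omega⟩
        rw [ih _ (Nat.lt_succ_iff.1 (τ n ⟨b, by omega⟩).2)] at e1
        simp only at e1 e2
        rw [e1, e2]
        ring
    have h2 := key (n + 1) le_rfl
    rw [hct, hvt] at h2
    have h3 : c (n + 1) 0 - (1 - t) ^ (n + 2) * v (n + 1) 0 = 0 := by
      refine (mul_eq_zero.1 (?_ : (1 - t) * _ = 0)).resolve_left ht
      linear_combination -h2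
    rw [← sub_eq_zero, key a ha, h3]

/-- The common shape of Worpitzky's identity and of its alternating analogue: the distribution of
a statistic that obeys a recurrence on the first letter is determined by any solution `V` of the
corresponding difference equation. -/
theorem sum_pow_stat_eq (stat : ∀ n, Equiv.Perm (Fin n) → ℕ) (e : ∀ n, Equiv.Perm (Fin n))
    (h0 : ∀ τ, stat 0 τ = 0) (h1 : ∀ τ, stat 1 τ = 0)
    (hstat : ∀ n (j : Fin (n + 2)) (τ : Equiv.Perm (Fin (n + 1))),
      stat (n + 2) (consPerm j (τ.trans (e (n + 1)))) =
        stat (n + 1) τ + if (e (n + 1) (τ 0)).castSucc < j then 1 else 0)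
    (V : ℕ → ℕ → ℕ → ℚ) (hV0 : ∀ m, V m 0 0 = 1)
    (hV : ∀ m n (a : Fin (n + 1)), V m (a + 1) (n - a) =
      V m a (n - a + 1) - V m ((e (n + 1)).symm a) (n - (e (n + 1)).symm a))
    (hVt : ∀ m n, V (m + 1) n 0 = V m 0 n) (hVt0 : ∀ n, V 0 (n + 1) 0 = 0) (n : ℕ) :
    (∑ σ : Equiv.Perm (Fin n), (PowerSeries.X : PowerSeries ℚ) ^ (stat n σ + 1)) =
      (1 - PowerSeries.X) ^ (n + 1) *
        PowerSeries.mk fun m => if 1 ≤ m then V m n 0 else 0 := by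
  have ht : (1 - PowerSeries.X : PowerSeries ℚ) ≠ 0 := fun h => by
    simpa using congrArg PowerSeries.constantCoeff h
  have key := eq_pow_mul_of_recurrence ht (fun n => (e (n + 1)).symm)
    (weightedSum PowerSeries.X stat e)
    (fun n a => PowerSeries.mk fun m => V m a (n - a)) ?_
    (weightedSum_succ _ stat e h0 h1 hstat) (weightedSum_self _ stat e) ?_ ?_ n 0 n.zero_le
  · have hX : (PowerSeries.mk fun m => if 1 ≤ m then V m n 0 else 0) =
        PowerSeries.X * PowerSeries.mk fun m => V m 0 n := by
      ext m
      cases m with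
      | zero => simp
      | succ m => simp [PowerSeries.coeff_succ_X_mul, hVt]
    rw [weightedSum_zero_right, Nat.sub_zero] at key
    rw [hX]
    simp only [pow_succ _ (stat n _), ← sum_mul]
    rw [key]
    ring
  · rw [weightedSum_zero_right]
    simp only [Nat.sub_zero, hV0]
    have := PowerSeries.mk_one_mul_one_sub_eq_one ℚ
    rw [mul_comm] at this
    exact (by simp [h0] : _ = (1 : PowerSeries ℚ)).trans this.symm
  · intro n a
    ext m
    have h : n + 1 - (a : ℕ) = n - a + 1 := by omega
    simp [hV, h]
  · intro n
    ext m
    cases m with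
    | zero => simp [hVt0]
    | succ m => simp [PowerSeries.coeff_succ_X_mul, hVt]

end AltEulerian

/-! ### The two statistics. -/

namespace AltEulerian

theorem descentSet_of_le_one {n : ℕ} (hn : n ≤ 1) (σ : Equiv.Perm (Fin n)) :
    (descentSet σ).card = 0 := by
  rw [Finset.card_eq_zero, descentSet, Finset.filter_eq_empty_iff]
  rintro i - ⟨h, -⟩
  omega

theorem altDescentSet_of_le_one {n : ℕ} (hn : n ≤ 1) (σ : Equiv.Perm (Fin n)) :
    (altDescentSet σ).card = 0 := by
  rw [Finset.card_eq_zero, altDescentSet, Finset.filter_eq_empty_iff]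
  rintro i - ⟨h, -⟩
  omega

theorem coe_sum_X_pow {ι : Type*} (s : Finset ι) (d : ι → ℕ) :
    ((∑ i ∈ s, Polynomial.X ^ d i : Polynomial ℚ) : PowerSeries ℚ) =
      ∑ i ∈ s, PowerSeries.X ^ d i := by
  rw [← Polynomial.coeToPowerSeries.ringHom_apply, map_sum]
  simp

theorem coe_eulerianPoly (n : ℕ) : (eulerianPoly n : PowerSeries ℚ) =
    (1 - PowerSeries.X) ^ (n + 1) *
      PowerSeries.mk fun m => if 1 ≤ m then (m : ℚ) ^ n else 0 := by
  -- The solution `m^a (m+1)^b` is `a! b! [x^a y^b]` of `exp (m x + (m+1) y)`.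
  have h := sum_pow_stat_eq (fun n σ => (descentSet σ).card) (fun n => Equiv.refl _)
    (descentSet_of_le_one zero_le_one) (descentSet_of_le_one le_rfl)
    (fun n j τ => card_descentSet_consPerm j τ) (fun m a b => (m : ℚ) ^ a * (m + 1 : ℚ) ^ b)
    (by simp) (fun m n a => by simp only [Equiv.refl_symm, Equiv.refl_apply]; ring)
    (by simp) (by simp) n
  simp only [pow_zero, mul_one] at h
  rw [← h, eulerianPoly, coe_sum_X_pow]

theorem coe_altEulerianPoly (n : ℕ) : (altEulerianPoly n : PowerSeries ℚ) =
    (1 - PowerSeries.X) ^ (n + 1) *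
      PowerSeries.mk fun m => if 1 ≤ m then egfCoeff (tanAddSec ^ m) n else 0 := by
  have h := sum_pow_stat_eq (fun n σ => (altDescentSet σ).card) (fun n => Fin.revPerm)
    (altDescentSet_of_le_one zero_le_one) (altDescentSet_of_le_one le_rfl)
    (fun n j τ => card_altDescentSet_consPerm j τ) tanAddSecPowRefined
    (fun m => by simp [tanAddSecPowRefined_zero_right, egfCoeff, constantCoeff_tanAddSec])
    (fun m n a => by
      -- Complementation sends `a` to `n - a`, so the last term of the recurrence has its two
      -- indices interchanged, as in `pairCoeff_succ`.
      have h1 : ((Fin.revPerm.symm a : Fin (n + 1)) : ℕ) = n - a := by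
        simp [Fin.revPerm_symm, Fin.val_rev]
      have h2 : n - (n - (a : ℕ)) = a := by omega
      rw [h1, h2]
      exact pairCoeff_succ _ _ _)
    (fun m n => by rw [tanAddSecPowRefined_zero_right, tanAddSecPowRefined_zero_left])
    (fun n => by simp [tanAddSecPowRefined_zero_right, egfCoeff, PowerSeries.coeff_one]) n
  simp only [tanAddSecPowRefined_zero_right] at h
  rw [← h, altEulerianPoly, coe_sum_X_pow]

end AltEulerian

theorem proposition5p2 (n : ℕ) :
    ((AltEulerian.eulerianPoly n : PowerSeries ℚ) * ((1 - PowerSeries.X) ^ (n + 1))⁻¹ =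
      PowerSeries.mk fun m =>
        if 1 ≤ m then AltEulerian.evalOnes (AltEulerian.gSym (PowerSeries.exp ℚ) n) m else 0) ∧
    ((AltEulerian.altEulerianPoly n : PowerSeries ℚ) * ((1 - PowerSeries.X) ^ (n + 1))⁻¹ =
      PowerSeries.mk fun m =>
        if 1 ≤ m then AltEulerian.evalOnes (AltEulerian.gSym AltEulerian.tanAddSec n) m
        else 0) := by
  have h : PowerSeries.constantCoeff ((1 - PowerSeries.X : PowerSeries ℚ) ^ (n + 1)) ≠ 0 := by
    simp
  simp only [AltEulerian.evalOnes_gSym _ PowerSeries.constantCoeff_exp,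
    AltEulerian.evalOnes_gSym _ AltEulerian.constantCoeff_tanAddSec,
    AltEulerian.egfCoeff_exp_pow]
  constructor
  · rw [AltEulerian.coe_eulerianPoly, mul_comm, ← mul_assoc, PowerSeries.inv_mul_cancel _ h,
      one_mul]
  · rw [AltEulerian.coe_altEulerianPoly, mul_comm, ← mul_assoc, PowerSeries.inv_mul_cancel _ h,
      one_mul]
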